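/- For $x,y\in G=\mathbb{R}^2\setminus\{0\}$ let $k(x,y)=\inf_\gamma\int_\gamma \frac{|dz|}{d(z,\partial G)}$, where $d(z,\partial G)$ is the Euclidean distance from $z$ to $\partial G=\{0\}$ and the infimum is over all rectifiable curves $\gamma$ in $G$ joining $x$ and $y$ (the quasihyperbolic metric of $G$), and for $r>0$ let $B_k(x,r)=\{y\in G: k(x,y)<r\}$ be the quasihyperbolic disk. A half-line is a set $\{z+tv: t>0\}$ or $\{z+tv: t\ge 0\}$ with $z,v\in\mathbb{R}^2$, $v\neq 0$. A set $D\subset\mathbb{R}^2$ is called close-to-convex if $\mathbb{R}^2\setminus D$ is the union of a family of pairwise disjoint half-lines. Theorem. The function $f(z)=\cos\sqrt{z^2-1}+\sqrt{z^2-1}\,\sin\sqrt{z^2-1}$ has exactly one zero $\lambda$ in the interval $(2,\pi)$, and $\lambda\approx 2.97169$ (that is, $|\lambda-2.97169|<5\cdot 10^{-6}$). For every $x\in\mathbb{R}^2\setminus\{0\}$ and every $r>0$, the quasihyperbolic disk $B_k(x,r)$ of $\mathbb{R}^2\setminus\{0\}$ is close-to-convex if $r\le\lambda$, and it is not close-to-convex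 if $r>\lambda$. -/

import Mathlib

open Set MeasureTheory
open scoped ENNReal

noncomputable section

/-- `γ`, restricted to `[0,1]`, is a rectifiable curve (continuous and of finite length)
in `G` joining `x` to `y`. -/
def IsRectifiableCurveIn {n : ℕ} (G : Set (EuclideanSpace ℝ (Fin n)))
    (x y : EuclideanSpace ℝ (Fin n)) (γ : ℝ → EuclideanSpace ℝ (Fin n)) : Prop :=
  ContinuousOn γ (Icc 0 1) ∧ eVariationOn γ (Icc 0 1) ≠ ⊤ ∧
    MapsTo γ (Icc 0 1) G ∧ γ 0 = x ∧ γ 1 = y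

/-- The quasihyperbolic length `∫_γ |dz| / d(z, ∂G)` of a rectifiable curve `γ : [0,1] → G`.
The integral with respect to arc length `|dz|` is `∫_0^L ds / d(γ°(s), ∂G)`, where `L` is the
Euclidean length of `γ` and `γ°` is its parametrization by arc length. -/
def qhLength {n : ℕ} (G : Set (EuclideanSpace ℝ (Fin n)))
    (γ : ℝ → EuclideanSpace ℝ (Fin n)) : ℝ≥0∞ :=
  ∫⁻ s in Icc (0 : ℝ) (eVariationOn γ (Icc 0 1)).toReal,
    (Metric.infEDist (naturalParameterization γ (Icc 0 1) 0 s) (frontier G))⁻¹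

/-- The quasihyperbolic metric `k_G(x,y)`: the infimum of the quasihyperbolic lengths of all
rectifiable curves in `G` joining `x` and `y`. -/
def qhDist {n : ℕ} (G : Set (EuclideanSpace ℝ (Fin n)))
    (x y : EuclideanSpace ℝ (Fin n)) : ℝ≥0∞ :=
  ⨅ (γ : ℝ → EuclideanSpace ℝ (Fin n)) (_ : IsRectifiableCurveIn G x y γ), qhLength G γ

/-- The (open) quasihyperbolic ball `B_k(x,r) = {y ∈ G : k_G(x,y) < r}`. -/
def qhBall {n : ℕ} (G : Set (EuclideanSpace ℝ (Fin n)))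
    (x : EuclideanSpace ℝ (Fin n)) (r : ℝ) : Set (EuclideanSpace ℝ (Fin n)) :=
  {y | y ∈ G ∧ qhDist G x y < ENNReal.ofReal r}

/-- Half-lines, without or with their end point `z`. -/
def IsHalfLine {n : ℕ} (H : Set (EuclideanSpace ℝ (Fin n))) : Prop :=
  ∃ z v : EuclideanSpace ℝ (Fin n), v ≠ 0 ∧
    (H = {p | ∃ t : ℝ, 0 < t ∧ p = t • v + z} ∨ H = {p | ∃ t : ℝ, 0 ≤ t ∧ p = t • v + z})

/-- `D` is close-to-convex: its complement is the union of a family of pairwise disjoint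
half-lines. -/
def IsCloseToConvex {n : ℕ} (D : Set (EuclideanSpace ℝ (Fin n))) : Prop :=
  ∃ S : Set (Set (EuclideanSpace ℝ (Fin n))),
    (∀ H ∈ S, IsHalfLine H) ∧ S.PairwiseDisjoint id ∧ ⋃₀ S = Dᶜ

/-- The function `cos √(z² - 1) + √(z² - 1) sin √(z² - 1)`. -/
def lambdaFun (z : ℝ) : ℝ :=
  Real.cos (Real.sqrt (z ^ 2 - 1)) +
    Real.sqrt (z ^ 2 - 1) * Real.sin (Real.sqrt (z ^ 2 - 1))

end

open Filter Topology
open scoped NNReal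

/-! The logarithm flattens the metric: quasihyperbolic distance in the punctured plane is
`‖Complex.log (y / x)‖` with the principal branch. For a curve parametrized by arc length, the norm
of the logarithm grows at rate at most `1 / ‖η t‖`, which gives the lower bound; the logarithmic
spiral `x * exp (t * w)` gives the upper bound. Multiplication by `x` is a similarity, so only
`logDisk r`, the set `‖log z‖ < r`, has to be studied.

At argument `θ` the inner boundary of this disk has modulus `exp (-√(r² - θ²))`, and its height has
logarithm `log (sin θ) - √(r² - θ²)`. For `r ≤ π` this increases on `(0, r)` when `cos θ + θ / r ≥
0` there. The critical radius is the one at which the minimum of `cos θ + θ / r` is zero: at the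
minimum `s` one has `sin s = 1 / r` and `cos s = -s / r`, so `s = √(r² - 1)` and `cos s + s * sin s
= 0`, the equation defining `λ`.

If `r ≤ λ`, monotonicity makes every horizontal section of the disk an interval, and the rest of
each horizontal line is two disjoint half-lines (`mem_logDisk_of_between`,
`rayCoverable_compl_of_ordConnected`).

If `r > λ`, the inner boundary is higher at some `θ < s` than at `s`, so the complement narrows to a
neck. A half-line in the complement through the boundary point `p` at `θ` must pass the neck
downwards to the left, and one through the conjugate of `p` upwards to the left. These two meet
(`direction_of_ray_avoiding_logDisk`, `not_rayCoverable_of_rays`). -/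

/-! ### Arc-length parametrization of continuous curves of bounded variation. -/

theorem continuousOn_variationOnFromTo_Icc {E : Type*} [PseudoMetricSpace E] {f : ℝ → E} {a b : ℝ}
    (hab : a ≤ b) (hf : ContinuousOn f (Icc a b)) (hv : LocallyBoundedVariationOn f (Icc a b)) :
    ContinuousOn (variationOnFromTo f (Icc a b) a) (Icc a b) := by
  intro t ht
  have hl : ContinuousWithinAt (variationOnFromTo f (Icc a b) a) (Icc a b ∩ Iio t) t := by
    have := variationOnFromTo.tendsto_left (left_mem_Icc.2 hab) ht hv
      ((hf t ht).mono_left (nhdsWithin_mono _ inter_subset_left))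
    simpa [ContinuousWithinAt] using this
  have hr : ContinuousWithinAt (variationOnFromTo f (Icc a b) a) (Icc a b ∩ Ioi t) t := by
    have := variationOnFromTo.tendsto_right (left_mem_Icc.2 hab) ht hv
      ((hf t ht).mono_left (nhdsWithin_mono _ inter_subset_left))
    simpa [ContinuousWithinAt] using this
  have h0 : ContinuousWithinAt (variationOnFromTo f (Icc a b) a) {t} t :=
    continuousWithinAt_singleton
  refine ((hl.union hr).union h0).mono fun u hu => ?_
  rcases lt_trichotomy u t with h | h | h
  · exact Or.inl (Or.inl ⟨hu, h⟩)
  · exact Or.inr h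
  · exact Or.inl (Or.inr ⟨hu, h⟩)

theorem image_variationOnFromTo_Icc {E : Type*} [PseudoMetricSpace E] {f : ℝ → E} {a b : ℝ}
    (hab : a ≤ b) (hf : ContinuousOn f (Icc a b)) (hv : BoundedVariationOn f (Icc a b)) :
    variationOnFromTo f (Icc a b) a '' Icc a b = Icc 0 (eVariationOn f (Icc a b)).toReal := by
  have hb : variationOnFromTo f (Icc a b) a b = (eVariationOn f (Icc a b)).toReal := by
    rw [variationOnFromTo.eq_of_le _ _ hab, inter_self]
  have ha : variationOnFromTo f (Icc a b) a a = 0 := variationOnFromTo.self _ _ _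
  apply Subset.antisymm
  · rintro _ ⟨t, ht, rfl⟩
    have hm := variationOnFromTo.monotoneOn hv.locallyBoundedVariationOn (left_mem_Icc.2 hab)
    refine ⟨ha ▸ hm (left_mem_Icc.2 hab) ht ht.1, hb ▸ hm ht (right_mem_Icc.2 hab) ht.2⟩
  · have := intermediate_value_Icc hab
      (continuousOn_variationOnFromTo_Icc hab hf hv.locallyBoundedVariationOn)
    rwa [ha, hb] at this

/-- Continuity of the curve makes its variation function take every value up to the total length, so
unit speed holds on the whole interval, and distance is at most variation. -/
theorem lipschitzOnWith_naturalParameterization {E : Type*} [PseudoMetricSpace E] {f : ℝ → E}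
    {a b : ℝ} (hab : a ≤ b) (hf : ContinuousOn f (Icc a b)) (hv : BoundedVariationOn f (Icc a b)) :
    LipschitzOnWith 1 (naturalParameterization f (Icc a b) a)
      (Icc 0 (eVariationOn f (Icc a b)).toReal) := by
  have hu := has_unit_speed_naturalParameterization f hv.locallyBoundedVariationOn
    (left_mem_Icc.2 hab)
  rw [image_variationOnFromTo_Icc hab hf hv, HasUnitSpeedOn,
    hasConstantSpeedOnWith_iff_ordered] at hu
  intro s hs t ht
  wlog hst : s ≤ t generalizing s t
  · rw [edist_comm, edist_comm s]
    exact this ht hs (le_of_not_ge hst)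
  refine (eVariationOn.edist_le (s := Icc 0 (eVariationOn f (Icc a b)).toReal ∩ Icc s t) _
    ⟨hs, le_rfl, hst⟩ ⟨ht, hst, le_rfl⟩).trans ?_
  rw [hu hs ht hst, edist_comm, edist_dist, Real.dist_eq, abs_of_nonneg (sub_nonneg.2 hst)]
  simp

/-! ### The lower bound for quasihyperbolic length. -/

/-- The principal branch of the logarithm has the smallest modulus among all branches. -/
theorem Complex.norm_log_exp_le (w : ℂ) : ‖log (exp w)‖ ≤ ‖w‖ := by
  have hre : (log (exp w)).re = w.re := by rw [log_re, norm_exp, Real.log_exp]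
  have him : |(log (exp w)).im| ≤ |w.im| := by
    rw [log_im]
    by_cases h : |w.im| ≤ Real.pi
    · by_cases h2 : w.im = -Real.pi
      · rw [h2, abs_neg, abs_of_pos Real.pi_pos]
        exact abs_arg_le_pi _
      · rw [← log_im, log_exp (lt_of_le_of_ne (abs_le.1 h).1 (Ne.symm h2)) (abs_le.1 h).2]
    · exact (abs_arg_le_pi _).trans (le_of_not_ge h)
  rw [norm_def, norm_def]
  apply Real.sqrt_le_sqrt
  rw [normSq_apply, normSq_apply, hre]
  nlinarith [sq_abs (log (exp w)).im, sq_abs w.im, abs_nonneg (log (exp w)).im]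

/-- `log z + log w` is some logarithm of `z * w`, and the principal one is the shortest. -/
theorem Complex.norm_log_mul_le {z w : ℂ} (hz : z ≠ 0) (hw : w ≠ 0) :
    ‖log (z * w)‖ ≤ ‖log z‖ + ‖log w‖ := by
  have h := norm_log_exp_le (log z + log w)
  rw [exp_add, exp_log hz, exp_log hw] at h
  exact h.trans (norm_add_le _ _)

/-- On the cut `arg` jumps only in sign, and `|arg w| = arccos (w.re / ‖w‖)` is continuous away from
zero. -/
theorem Complex.continuousAt_norm_log {z : ℂ} (hz : z ≠ 0) : ContinuousAt (fun w => ‖log w‖) z := by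
  have h : (fun w : ℂ => ‖log w‖) = fun w => √(Real.log ‖w‖ ^ 2 + |arg w| ^ 2) := by
    ext w
    rw [norm_def, normSq_apply, log_re, log_im, sq_abs]
    ring_nf
  rw [h]
  have h1 : ContinuousAt (fun w : ℂ => Real.log ‖w‖) z :=
    continuousAt_id.norm.log (norm_ne_zero_iff.2 hz)
  have h2 : ContinuousAt (fun w : ℂ => |arg w|) z := by
    have heq : (fun w : ℂ => Real.arccos (w.re / ‖w‖)) =ᶠ[𝓝 z] fun w => |arg w| := by
      filter_upwards [isOpen_ne.mem_nhds hz] with w hw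
      rw [← cos_arg hw, ← Real.cos_abs, Real.arccos_cos (abs_nonneg _) (abs_arg_le_pi _)]
    refine ContinuousAt.congr ?_ heq
    exact Real.continuous_arccos.continuousAt.comp
      (continuous_re.continuousAt.div continuousAt_id.norm (norm_ne_zero_iff.2 hz))
  exact ((h1.pow 2).add (h2.pow 2)).sqrt

/-- A comparison of right slopes: subadditivity of `‖log‖` bounds the increment from `t` to `z` by
`‖log (η z / η t)‖`, which is at most `(z - t) / ‖η t‖` to first order. Since `‖log‖` is continuous
across the cut, no continuous branch along the curve is needed. -/
theorem norm_log_div_le_integral_of_lipschitzWith {η : ℝ → ℂ} (hη : LipschitzWith 1 η)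
    (h0 : ∀ t, η t ≠ 0) {L : ℝ} (hL : 0 ≤ L) :
    ‖Complex.log (η L / η 0)‖ ≤ ∫ t in (0 : ℝ)..L, ‖η t‖⁻¹ := by
  have hc : Continuous fun t => ‖η t‖⁻¹ :=
    hη.continuous.norm.inv₀ fun t => norm_ne_zero_iff.2 (h0 t)
  have hd : ∀ t, HasDerivAt (fun u => ∫ t in (0 : ℝ)..u, ‖η t‖⁻¹) (‖η t‖⁻¹) t := fun t =>
    intervalIntegral.integral_hasDerivAt_right (hc.intervalIntegrable _ _)
      hc.aestronglyMeasurable.stronglyMeasurableAtFilter hc.continuousAt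
  refine image_le_of_liminf_slope_right_le_deriv_boundary (a := 0) (b := L)
    (f := fun t => ‖Complex.log (η t / η 0)‖) (B := fun u => ∫ t in (0 : ℝ)..u, ‖η t‖⁻¹)
    (B' := fun t => ‖η t‖⁻¹) ?_ ?_ (fun t _ => (hd t).continuousAt.continuousWithinAt)
    (fun t _ => (hd t).hasDerivWithinAt) ?_ (right_mem_Icc.2 hL)
  · intro t _
    exact (ContinuousAt.comp (f := fun t => η t / η 0)
      (Complex.continuousAt_norm_log (div_ne_zero (h0 t) (h0 0)))
      (hη.continuous.continuousAt.div_const _)).continuousWithinAt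
  · simp [h0 0]
  · intro t _ r hr
    apply Eventually.frequently
    have hpos : 0 < ‖η t‖ := norm_pos_iff.2 (h0 t)
    have key : ∀ᶠ z in 𝓝[>] t, (z - t) / ‖η t‖ < 1 ∧
        ((z - t) / ‖η t‖ * (1 - (z - t) / ‖η t‖)⁻¹ / 2 + 1) * ‖η t‖⁻¹ < r := by
      have c0 : ContinuousAt (fun z => (z - t) / ‖η t‖) t := by fun_prop
      have c1 : ContinuousAt (fun z => ((z - t) / ‖η t‖ * (1 - (z - t) / ‖η t‖)⁻¹ / 2 + 1)
          * ‖η t‖⁻¹) t := by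
        refine (((c0.mul ((continuousAt_const.sub c0).inv₀ (by simp))).div_const _).add
          continuousAt_const).mul continuousAt_const
      refine nhdsWithin_le_nhds ((c0.eventually_lt continuousAt_const (by simp)).and
        (c1.eventually_lt continuousAt_const (by simpa using hr)))
    filter_upwards [key, self_mem_nhdsWithin] with z ⟨hz1, hz2⟩ hzt
    have hzt' : 0 < z - t := sub_pos.2 hzt
    refine lt_of_le_of_lt ?_ hz2
    have e1 : η z / η 0 = (1 + (η z - η t) / η t) * (η t / η 0) := by
      have := h0 t; have := h0 0; field_simp; ring
    have hn : ‖(η z - η t) / η t‖ ≤ (z - t) / ‖η t‖ := by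
      rw [norm_div]
      gcongr
      have := hη.dist_le_mul z t
      rwa [dist_eq_norm, Real.dist_eq, abs_of_pos hzt', NNReal.coe_one, one_mul] at this
    have h1 : ‖Complex.log (1 + (η z - η t) / η t)‖ ≤
        ((z - t) / ‖η t‖) ^ 2 * (1 - (z - t) / ‖η t‖)⁻¹ / 2 + (z - t) / ‖η t‖ := by
      refine (Complex.norm_log_one_add_le (hn.trans_lt hz1)).trans ?_
      have h3 : 0 < 1 - (z - t) / ‖η t‖ := by linarith
      have h4 : (1 - ‖(η z - η t) / η t‖)⁻¹ ≤ (1 - (z - t) / ‖η t‖)⁻¹ := by gcongr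
      have h5 : 0 < (1 - ‖(η z - η t) / η t‖)⁻¹ := inv_pos.2 (by linarith)
      gcongr
    have h2 : ‖Complex.log (η z / η 0)‖ ≤
        ‖Complex.log (1 + (η z - η t) / η t)‖ + ‖Complex.log (η t / η 0)‖ := by
      rw [e1]
      apply Complex.norm_log_mul_le _ (div_ne_zero (h0 t) (h0 0))
      rw [show 1 + (η z - η t) / η t = η z / η t by have := h0 t; field_simp; ring]
      exact div_ne_zero (h0 z) (h0 t)
    rw [slope_def_field, div_le_iff₀ hzt']
    have : ((z - t) / ‖η t‖ * (1 - (z - t) / ‖η t‖)⁻¹ / 2 + 1) * ‖η t‖⁻¹ * (z - t) =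
      ((z - t) / ‖η t‖) ^ 2 * (1 - (z - t) / ‖η t‖)⁻¹ / 2 + (z - t) / ‖η t‖ := by
      ring
    linarith

theorem ofReal_norm_log_div_le_lintegral {η : ℝ → ℂ} {L : ℝ} (hL : 0 ≤ L)
    (hη : LipschitzOnWith 1 η (Icc 0 L)) (h0 : ∀ t ∈ Icc 0 L, η t ≠ 0) :
    ENNReal.ofReal ‖Complex.log (η L / η 0)‖ ≤ ∫⁻ t in Icc 0 L, ‖η t‖ₑ⁻¹ := by
  -- Freezing the curve outside `[0, L]` makes it Lipschitz and nonvanishing on the whole line.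
  set ζ : ℝ → ℂ := fun t => η (projIcc 0 L hL t) with hζ
  have hζη : ∀ t ∈ Icc 0 L, ζ t = η t := fun t ht => by rw [hζ]; simp [projIcc_of_mem hL ht]
  have hlip : LipschitzWith 1 ζ := by
    have := hη.to_restrict.comp (LipschitzWith.projIcc hL)
    rw [mul_one] at this
    exact this
  have hne : ∀ t, ζ t ≠ 0 := fun t => h0 _ (projIcc 0 L hL t).2
  have hc : Continuous fun t => ‖ζ t‖⁻¹ :=
    hlip.continuous.norm.inv₀ fun t => norm_ne_zero_iff.2 (hne t)
  have key := norm_log_div_le_integral_of_lipschitzWith hlip hne hL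
  rw [hζη _ (left_mem_Icc.2 hL), hζη _ (right_mem_Icc.2 hL),
    intervalIntegral.integral_of_le hL, ← integral_Icc_eq_integral_Ioc] at key
  refine (ENNReal.ofReal_le_ofReal key).trans ?_
  rw [ofReal_integral_eq_lintegral_ofReal (hc.integrableOn_Icc)
    (Eventually.of_forall fun t => inv_nonneg.2 (norm_nonneg _))]
  refine le_of_eq (setLIntegral_congr_fun measurableSet_Icc fun t ht => ?_)
  rw [ENNReal.ofReal_inv_of_pos (norm_pos_iff.2 (hne t)), ofReal_norm, hζη t ht]

/-! ### The quasihyperbolic metric of the punctured plane. -/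

/-- The identification of `ℂ` with the Euclidean plane. -/
noncomputable def planeEquiv : ℂ ≃ₗᵢ[ℝ] EuclideanSpace ℝ (Fin 2) :=
  Complex.orthonormalBasisOneI.repr

theorem frontier_compl_singleton_zero :
    frontier ({0}ᶜ : Set (EuclideanSpace ℝ (Fin 2))) = {0} := by
  rw [frontier_compl, isClosed_singleton.frontier_eq, interior_singleton, sdiff_empty]

theorem qhLength_compl_zero (γ : ℝ → EuclideanSpace ℝ (Fin 2)) :
    qhLength {0}ᶜ γ = ∫⁻ s in Icc (0 : ℝ) (eVariationOn γ (Icc 0 1)).toReal,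
      ‖naturalParameterization γ (Icc 0 1) 0 s‖ₑ⁻¹ := by
  unfold qhLength
  simp only [frontier_compl_singleton_zero, Metric.infEDist_singleton, edist_zero_right]

theorem naturalParameterization_variationOnFromTo {E : Type*} [MetricSpace E] {f : ℝ → E}
    {s : Set ℝ} (hf : LocallyBoundedVariationOn f s) {a b : ℝ} (ha : a ∈ s) (hb : b ∈ s) :
    naturalParameterization f s a (variationOnFromTo f s a b) = f b :=
  edist_eq_zero.1 (edist_naturalParameterization_eq_zero hf ha hb)

theorem ofReal_norm_log_div_le_qhDist (x y : ℂ) :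
    ENNReal.ofReal ‖Complex.log (y / x)‖ ≤ qhDist {0}ᶜ (planeEquiv x) (planeEquiv y) := by
  refine le_iInf₂ fun γ hγ => ?_
  obtain ⟨hc, hv, hm, h0, h1⟩ := hγ
  have hv' : BoundedVariationOn γ (Icc 0 1) := hv
  rw [qhLength_compl_zero]
  set L := (eVariationOn γ (Icc 0 1)).toReal with hLdef
  set ν := naturalParameterization γ (Icc 0 1) 0 with hν
  have hL : 0 ≤ L := ENNReal.toReal_nonneg
  have m0 : (0 : ℝ) ∈ Icc (0 : ℝ) 1 := left_mem_Icc.2 zero_le_one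
  have m1 : (1 : ℝ) ∈ Icc (0 : ℝ) 1 := right_mem_Icc.2 zero_le_one
  have hval := fun t (ht : t ∈ Icc (0 : ℝ) 1) =>
    naturalParameterization_variationOnFromTo hv'.locallyBoundedVariationOn m0 ht
  have e0 : ν 0 = planeEquiv x := by
    rw [← h0, ← hval 0 m0, variationOnFromTo.self]
  have e1 : ν L = planeEquiv y := by
    rw [← h1, ← hval 1 m1, variationOnFromTo.eq_of_le _ _ zero_le_one, inter_self]
  have hne : ∀ t ∈ Icc 0 L, planeEquiv.symm (ν t) ≠ 0 := by
    intro t ht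
    rw [hLdef, ← image_variationOnFromTo_Icc zero_le_one hc hv'] at ht
    obtain ⟨u, hu, rfl⟩ := ht
    rw [hν, hval u hu]
    simpa using hm hu
  have := ofReal_norm_log_div_le_lintegral (η := fun t => planeEquiv.symm (ν t)) hL ?_ hne
  · simpa [e0, e1] using this
  · have := planeEquiv.symm.lipschitz.comp_lipschitzOnWith
      (lipschitzOnWith_naturalParameterization zero_le_one hc hv')
    rw [one_mul] at this
    exact this

theorem eVariationOn_Icc_le_of_lipschitzOnWith {E : Type*} [PseudoMetricSpace E] {f : ℝ → E}
    {C : ℝ≥0} {a b : ℝ} (h : LipschitzOnWith C f (Icc a b)) :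
    eVariationOn f (Icc a b) ≤ C * ENNReal.ofReal (b - a) := by
  have := h.comp_eVariationOn_le (g := id) (s := Icc a b) (fun _ h => h)
  rwa [eVariationOn_id_Icc] at this

/-- A subdivision bound for quasihyperbolic length in the punctured plane. -/
theorem qhLength_compl_zero_le_of_subdivision {γ : ℝ → EuclideanSpace ℝ (Fin 2)}
    (hc : ContinuousOn γ (Icc 0 1)) (hv : BoundedVariationOn γ (Icc 0 1)) {n : ℕ} (hn : 0 < n)
    {M : ℝ≥0∞} {C m : ℕ → ℝ≥0}
    (hC : ∀ i < n, LipschitzOnWith (C i) γ (Icc (i / n) ((i + 1) / n)))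
    (hm : ∀ i < n, ∀ t ∈ Icc (i / n : ℝ) ((i + 1) / n), (m i : ℝ≥0∞) ≤ ‖γ t‖ₑ)
    (hM : ∀ i < n, (m i : ℝ≥0∞)⁻¹ * C i ≤ M) :
    qhLength {0}ᶜ γ ≤ M := by
  have m0 : (0 : ℝ) ∈ Icc (0 : ℝ) 1 := left_mem_Icc.2 zero_le_one
  have hlv := hv.locallyBoundedVariationOn
  set V := variationOnFromTo γ (Icc 0 1) 0 with hV
  set ν := naturalParameterization γ (Icc 0 1) 0 with hν
  have hn' : (0 : ℝ) < n := by exact_mod_cast hn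
  have hVmono : MonotoneOn V (Icc 0 1) := variationOnFromTo.monotoneOn hlv m0
  have hVc : ContinuousOn V (Icc 0 1) := continuousOn_variationOnFromTo_Icc zero_le_one hc hlv
  have hV0 : V 0 = 0 := variationOnFromTo.self _ _ _
  -- Each piece has length at most `C i / n` and integrand at most `1 / m i`, hence contributes at
  -- most `M / n`.
  have key : ∀ i : ℕ, i ≤ n → ∫⁻ s in Icc 0 (V (i / n)), ‖ν s‖ₑ⁻¹ ≤
      i * (M * ENNReal.ofReal (1 / n)) := by
    intro i
    induction i with
    | zero => intro _; simp [hV0]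
    | succ i ih =>
      intro hi
      have hi' : i < n := hi
      have hq0 : (0 : ℝ) ≤ i / n := by positivity
      have hq1 : ((i : ℝ) + 1) / n ≤ 1 := (div_le_one hn').2 (by exact_mod_cast hi)
      have hq : (i : ℝ) / n ≤ (i + 1) / n := by gcongr; linarith
      have ma : (i / n : ℝ) ∈ Icc (0 : ℝ) 1 := ⟨hq0, hq.trans hq1⟩
      have mb : (((i : ℝ) + 1) / n) ∈ Icc (0 : ℝ) 1 := ⟨hq0.trans hq, hq1⟩
      have hsub : Icc (i / n : ℝ) ((i + 1) / n) ⊆ Icc 0 1 := Icc_subset_Icc hq0 hq1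
      have hcover : Icc 0 (V ((i + 1) / n)) ⊆
          Icc 0 (V (i / n)) ∪ Icc (V (i / n)) (V ((i + 1) / n)) := by
        intro s hs
        rcases le_total s (V (i / n)) with h | h
        · exact Or.inl ⟨hs.1, h⟩
        · exact Or.inr ⟨h, hs.2⟩
      have hpiece : ∫⁻ s in Icc (V (i / n)) (V ((i + 1) / n)), ‖ν s‖ₑ⁻¹ ≤
          M * ENNReal.ofReal (1 / n) := by
        have hb : ∀ s ∈ Icc (V (i / n)) (V ((i + 1) / n)), ‖ν s‖ₑ⁻¹ ≤ (m i : ℝ≥0∞)⁻¹ := by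
          intro s hs
          obtain ⟨t, ht, rfl⟩ := intermediate_value_Icc hq (hVc.mono hsub) hs
          rw [hν, hV, naturalParameterization_variationOnFromTo hlv m0 (hsub ht)]
          exact ENNReal.inv_le_inv.2 (hm i hi' t ht)
        have hlen : ENNReal.ofReal (V ((i + 1) / n) - V (i / n)) ≤
            C i * ENNReal.ofReal (1 / n) := by
          have e : V ((i + 1) / n) - V (i / n) =
              (eVariationOn γ (Icc (i / n : ℝ) ((i + 1) / n))).toReal := by
            rw [hV, variationOnFromTo.sub_right hlv m0 mb ma, variationOnFromTo.eq_of_le _ _ hq,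
              inter_eq_right.2 hsub]
          have := eVariationOn_Icc_le_of_lipschitzOnWith (hC i hi')
          rw [show ((i : ℝ) + 1) / n - i / n = 1 / n by ring] at this
          rw [e]
          exact ENNReal.ofReal_toReal_le.trans this
        calc ∫⁻ s in Icc (V (i / n)) (V ((i + 1) / n)), ‖ν s‖ₑ⁻¹
            ≤ ∫⁻ _ in Icc (V (i / n)) (V ((i + 1) / n)), (m i : ℝ≥0∞)⁻¹ :=
              setLIntegral_mono' measurableSet_Icc hb
          _ = (m i : ℝ≥0∞)⁻¹ * ENNReal.ofReal (V ((i + 1) / n) - V (i / n)) := by simp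
          _ ≤ (m i : ℝ≥0∞)⁻¹ * (C i * ENNReal.ofReal (1 / n)) := by gcongr
          _ ≤ M * ENNReal.ofReal (1 / n) := by rw [← mul_assoc]; gcongr; exact hM i hi'
      push_cast
      calc _ ≤ ∫⁻ s in Icc 0 (V (i / n)) ∪ Icc (V (i / n)) (V ((i + 1) / n)), ‖ν s‖ₑ⁻¹ :=
            lintegral_mono_set hcover
        _ ≤ _ := lintegral_union_le _ _ _
        _ ≤ i * (M * ENNReal.ofReal (1 / n)) + M * ENNReal.ofReal (1 / n) :=
            add_le_add (ih hi'.le) hpiece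
        _ = _ := by ring
  have h1 := key n le_rfl
  rw [div_self hn'.ne', hV, variationOnFromTo.eq_of_le _ _ zero_le_one, inter_self] at h1
  rw [qhLength_compl_zero]
  refine h1.trans (le_of_eq ?_)
  rw [mul_left_comm, ← ENNReal.ofReal_natCast, ← ENNReal.ofReal_mul hn'.le,
    mul_one_div_cancel hn'.ne', ENNReal.ofReal_one, mul_one]

/-- The logarithmic spiral from `x` to `y` is a segment in the logarithmic coordinate. Cutting it
into `n` equal parameter intervals bounds its quasihyperbolic length by `exp (2 * |w.re| / n) *
‖w‖`, which tends to `‖w‖`. -/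
theorem qhDist_le_ofReal_norm_log_div {x y : ℂ} (hx : x ≠ 0) (hy : y ≠ 0) :
    qhDist {0}ᶜ (planeEquiv x) (planeEquiv y) ≤ ENNReal.ofReal ‖Complex.log (y / x)‖ := by
  set w := Complex.log (y / x) with hw
  set g : ℝ → ℂ := fun t => x * Complex.exp (t * w) with hg
  have hder : ∀ t, HasDerivAt g (g t * w) t := by
    intro t
    have h1 : HasDerivAt (fun t : ℝ => (t : ℂ) * w) (1 * w) t :=
      (Complex.ofRealCLM.hasDerivAt (x := t)).mul_const w
    have := (h1.cexp).const_mul x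
    exact this.congr_deriv (by simp only [hg]; ring)
  have hnorm : ∀ t, ‖g t‖ = ‖x‖ * Real.exp (t * w.re) := by
    intro t
    rw [norm_mul, Complex.norm_exp, Complex.re_ofReal_mul]
  have hlip : ∀ a b : ℝ, ∀ C : ℝ≥0, (∀ t ∈ Icc a b, ‖x‖ * Real.exp (t * w.re) * ‖w‖ ≤ C) →
      LipschitzOnWith C (fun t => planeEquiv (g t)) (Icc a b) := by
    intro a b C h
    have h1 : LipschitzOnWith C g (Icc a b) := by
      refine (convex_Icc a b).lipschitzOnWith_of_nnnorm_hasDerivWithin_le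
        (fun t _ => (hder t).hasDerivWithinAt) fun t ht => ?_
      rw [← NNReal.coe_le_coe, coe_nnnorm, norm_mul, hnorm]
      exact h t ht
    have := planeEquiv.lipschitz.comp_lipschitzOnWith h1
    rw [one_mul] at this
    exact this
  have hexp : ∀ t ∈ Icc (0 : ℝ) 1, ‖x‖ * Real.exp (t * w.re) * ‖w‖ ≤
      ‖x‖ * Real.exp |w.re| * ‖w‖ := by
    intro t ht
    gcongr
    nlinarith [le_abs_self w.re, abs_nonneg w.re, ht.1, ht.2]
  have hcont : Continuous fun t => planeEquiv (g t) :=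
    planeEquiv.continuous.comp (by fun_prop)
  have hbv : BoundedVariationOn (fun t => planeEquiv (g t)) (Icc 0 1) := by
    have := eVariationOn_Icc_le_of_lipschitzOnWith
      (hlip 0 1 ⟨‖x‖ * Real.exp |w.re| * ‖w‖, by positivity⟩ hexp)
    exact ne_top_of_le_ne_top (ENNReal.mul_ne_top ENNReal.coe_ne_top ENNReal.ofReal_ne_top) this
  have hcurve : IsRectifiableCurveIn {0}ᶜ (planeEquiv x) (planeEquiv y)
      (fun t => planeEquiv (g t)) := by
    refine ⟨hcont.continuousOn, hbv, fun t _ => ?_, ?_, ?_⟩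
    · have : g t ≠ 0 := mul_ne_zero hx (Complex.exp_ne_zero _)
      simpa only [mem_compl_iff, mem_singleton_iff, LinearIsometryEquiv.map_eq_zero_iff] using this
    · simp only [hg, Complex.ofReal_zero, zero_mul, Complex.exp_zero, mul_one]
    · simp only [hg, Complex.ofReal_one, one_mul, hw, Complex.exp_log (div_ne_zero hy hx)]
      rw [mul_div_cancel₀ _ hx]
  have hbound : ∀ n : ℕ, 0 < n → qhDist {0}ᶜ (planeEquiv x) (planeEquiv y) ≤
      ENNReal.ofReal (Real.exp (2 * |w.re| / n) * ‖w‖) := by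
    intro n hn
    have hn' : (0 : ℝ) < n := by exact_mod_cast hn
    have hvar : ∀ i : ℕ, ∀ t ∈ Icc (i / n : ℝ) ((i + 1) / n),
        |t * w.re - i / n * w.re| ≤ |w.re| / n := by
      intro i t ht
      have h1 : |t - i / n| ≤ 1 / n := by
        have : ((i : ℝ) + 1) / n = i / n + 1 / n := by ring
        rw [abs_of_nonneg (sub_nonneg.2 ht.1)]
        linarith [ht.2]
      rw [← sub_mul, abs_mul]
      calc _ ≤ 1 / n * |w.re| := by gcongr
        _ = |w.re| / n := by ring
    have hxpos : 0 < ‖x‖ := norm_pos_iff.2 hx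
    -- On a piece the exponent `t * w.re` differs from its initial value by at most `|w.re| / n`;
    -- `m` and `C` are the resulting bounds for modulus and speed.
    refine (iInf₂_le _ hcurve).trans (qhLength_compl_zero_le_of_subdivision hcont.continuousOn hbv
      hn (m := fun i => (‖x‖ * Real.exp (i / n * w.re - |w.re| / n)).toNNReal)
      (C := fun i => (‖x‖ * Real.exp (i / n * w.re + |w.re| / n) * ‖w‖).toNNReal)
      (fun i _ => hlip _ _ _ fun t ht => ?_) (fun i _ t ht => ?_) (fun i _ => ?_))
    · rw [Real.coe_toNNReal _ (by positivity)]
      have := (abs_le.1 (hvar i t ht)).2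
      gcongr
      linarith
    · change ENNReal.ofReal _ ≤ _
      rw [← ofReal_norm, LinearIsometryEquiv.norm_map, hnorm]
      have := (abs_le.1 (hvar i t ht)).1
      apply ENNReal.ofReal_le_ofReal
      gcongr
      linarith
    · change (ENNReal.ofReal _)⁻¹ * ENNReal.ofReal _ ≤ _
      rw [← ENNReal.ofReal_inv_of_pos (by positivity), ← ENNReal.ofReal_mul (by positivity)]
      apply ENNReal.ofReal_le_ofReal (le_of_eq _)
      rw [show (i : ℝ) / n * w.re + |w.re| / n =
        (i / n * w.re - |w.re| / n) + 2 * |w.re| / n by ring, Real.exp_add]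
      field_simp
  have hlim : Tendsto (fun n : ℕ => ENNReal.ofReal (Real.exp (2 * |w.re| / n) * ‖w‖)) atTop
      (𝓝 (ENNReal.ofReal ‖w‖)) := by
    refine ENNReal.tendsto_ofReal ?_
    have := ((Real.continuous_exp.tendsto 0).comp
      (tendsto_const_div_atTop_nhds_zero_nat (2 * |w.re|))).mul_const ‖w‖
    simpa using this
  exact ge_of_tendsto hlim ((eventually_gt_atTop 0).mono fun n hn => hbound n hn)

theorem qhDist_compl_zero {x y : ℂ} (hx : x ≠ 0) (hy : y ≠ 0) :
    qhDist {0}ᶜ (planeEquiv x) (planeEquiv y) = ENNReal.ofReal ‖Complex.log (y / x)‖ :=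
  le_antisymm (qhDist_le_ofReal_norm_log_div hx hy) (ofReal_norm_log_div_le_qhDist x y)

/-- The quasihyperbolic disk of radius `r` about `1` in the punctured plane, seen in `ℂ`. -/
def logDisk (r : ℝ) : Set ℂ := {z | z ≠ 0 ∧ ‖Complex.log z‖ < r}

theorem planeEquiv_mem_qhBall {x : ℂ} (hx : x ≠ 0) (y : ℂ) (r : ℝ) :
    planeEquiv y ∈ qhBall {0}ᶜ (planeEquiv x) r ↔ y / x ∈ logDisk r := by
  by_cases hy : y = 0
  · simp [hy, qhBall, logDisk]
  · have h := ENNReal.ofReal_lt_ofReal_iff_of_nonneg (q := r) (norm_nonneg (Complex.log (y / x)))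
    rw [← qhDist_compl_zero hx hy] at h
    simp [qhBall, logDisk, hy, hx, h]

/-! ### The number `λ`: uniqueness, numerical value, trigonometric form. -/

/-- The derivative is `s * cos s`, negative beyond `π / 2`. -/
theorem strictAntiOn_cos_add_mul_sin :
    StrictAntiOn (fun s : ℝ => Real.cos s + s * Real.sin s) (Icc (Real.pi / 2) Real.pi) := by
  refine strictAntiOn_of_deriv_neg (convex_Icc _ _) (by fun_prop) fun s hs => ?_
  rw [interior_Icc] at hs
  have hd : HasDerivAt (fun s : ℝ => Real.cos s + s * Real.sin s) (s * Real.cos s) s :=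
    ((Real.hasDerivAt_cos s).add ((hasDerivAt_id s).mul (Real.hasDerivAt_sin s))).congr_deriv
      (by simp)
  rw [hd.deriv]
  have : 0 < s := by linarith [Real.pi_pos, hs.1]
  exact mul_neg_of_pos_of_neg this
    (Real.cos_neg_of_pi_div_two_lt_of_lt hs.1 (by linarith [Real.pi_pos, hs.2]))

theorem sqrt_sq_sub_one_mem {z : ℝ} (hz : z ∈ Icc 2 Real.pi) :
    √(z ^ 2 - 1) ∈ Icc (Real.pi / 2) Real.pi := by
  constructor
  · apply Real.le_sqrt_of_sq_le
    nlinarith [Real.pi_lt_d2, Real.pi_pos, hz.1]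
  · rw [Real.sqrt_le_left Real.pi_pos.le]
    nlinarith [hz.1, hz.2]

theorem lambdaFun_strictAntiOn : StrictAntiOn lambdaFun (Icc 2 Real.pi) := by
  intro a ha b hb hab
  refine strictAntiOn_cos_add_mul_sin (sqrt_sq_sub_one_mem ha) (sqrt_sq_sub_one_mem hb)
    (Real.sqrt_lt_sqrt ?_ ?_) <;> nlinarith [ha.1]

theorem continuous_lambdaFun : Continuous lambdaFun := by
  unfold lambdaFun
  fun_prop

theorem abs_cos_sin_sub_taylor_le {x : ℝ} (hx : |x| ≤ 1) :
    |Real.cos x - (1 - x ^ 2 / 2 + x ^ 4 / 24 - x ^ 6 / 720)| ≤ |x| ^ 8 / 35840 ∧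
    |Real.sin x - (x - x ^ 3 / 6 + x ^ 5 / 120 - x ^ 7 / 5040)| ≤ |x| ^ 8 / 35840 := by
  have h := Complex.exp_bound (x := x * Complex.I) (by simpa using hx) (n := 8) (by norm_num)
  have hs : ∑ m ∈ Finset.range 8, ((x : ℂ) * Complex.I) ^ m / (m.factorial : ℂ) =
      ((1 - x ^ 2 / 2 + x ^ 4 / 24 - x ^ 6 / 720 : ℝ) : ℂ) +
      ((x - x ^ 3 / 6 + x ^ 5 / 120 - x ^ 7 / 5040 : ℝ) : ℂ) * Complex.I := by
    have i2 := Complex.I_sq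
    have i3 : Complex.I ^ 3 = -Complex.I := Complex.I_pow_three
    have i4 := Complex.I_pow_four
    have i5 : Complex.I ^ 5 = Complex.I := by rw [pow_succ, i4, one_mul]
    have i6 : Complex.I ^ 6 = -1 := by rw [pow_succ, i5, ← sq, i2]
    have i7 : Complex.I ^ 7 = -Complex.I := by rw [pow_succ, i6, neg_one_mul]
    simp only [Finset.sum_range_succ, Finset.sum_range_zero, mul_pow, i2, i3, i4, i5, i6, i7,
      Nat.factorial]
    push_cast
    ring
  rw [hs, Complex.exp_mul_I, ← Complex.ofReal_cos, ← Complex.ofReal_sin] at h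
  -- The remainder constant is `9 / (8! * 8) = 1 / 35840`.
  have hb : ‖(x : ℂ) * Complex.I‖ ^ 8 * ((Nat.succ 8 : ℝ) * (((8).factorial : ℝ) * (8 : ℕ))⁻¹) =
      |x| ^ 8 / 35840 := by
    simp [Nat.factorial]
    ring
  rw [hb] at h
  constructor
  · refine le_trans (le_of_eq_of_le (congrArg _ ?_) (Complex.abs_re_le_norm _)) h
    simp only [Complex.sub_re, Complex.add_re, Complex.re_ofReal_mul, Complex.ofReal_re,
      Complex.I_re]
    ring
  · refine le_trans (le_of_eq_of_le (congrArg _ ?_) (Complex.abs_im_le_norm _)) h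
    simp only [Complex.sub_im, Complex.add_im, Complex.im_ofReal_mul, Complex.ofReal_im,
      Complex.I_im]
    ring

/-- Reflection at `π` moves the evaluation to a small argument, where the Taylor polynomials are
accurate. -/
theorem cos_add_mul_sin_pi_sub (q : ℝ) :
    Real.cos (Real.pi - q) + (Real.pi - q) * Real.sin (Real.pi - q) =
      -Real.cos q + (Real.pi - q) * Real.sin q := by
  rw [Real.cos_pi_sub, Real.sin_pi_sub]

theorem lambdaFun_left_pos : 0 < lambdaFun 2.971685 := by
  have p1 := Real.pi_gt_d6
  have p2 := Real.pi_lt_d6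
  -- `0.343215` is slightly below `π - √(2.971685² - 1)`; since the function decreases, its value at
  -- `π - 0.343215` is a lower bound.
  have hle : √((2.971685 : ℝ) ^ 2 - 1) ≤ Real.pi - 0.343215 := by
    rw [Real.sqrt_le_left (by linarith)]
    nlinarith
  refine lt_of_lt_of_le ?_ (strictAntiOn_cos_add_mul_sin.antitoneOn
    (sqrt_sq_sub_one_mem ⟨by norm_num, by linarith⟩) ⟨by linarith, by linarith⟩ hle)
  refine lt_of_lt_of_eq ?_ (cos_add_mul_sin_pi_sub _).symm
  obtain ⟨h1, h2⟩ := abs_cos_sin_sub_taylor_le (x := 0.343215) (by norm_num [abs_le])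
  rw [abs_of_pos (by norm_num : (0 : ℝ) < 0.343215), abs_le] at h1 h2
  norm_num at h1 h2
  nlinarith [h1.1, h1.2, h2.1, h2.2]

theorem lambdaFun_right_neg : lambdaFun 2.971695 < 0 := by
  have p1 := Real.pi_gt_d20
  have p2 := Real.pi_lt_d20
  -- `0.343206` is slightly above `π - √(2.971695² - 1)`, which gives an upper bound.
  have hle : Real.pi - 0.343206 ≤ √((2.971695 : ℝ) ^ 2 - 1) := by
    apply Real.le_sqrt_of_sq_le
    nlinarith
  refine lt_of_le_of_lt (strictAntiOn_cos_add_mul_sin.antitoneOn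
    ⟨by linarith, by linarith⟩ (sqrt_sq_sub_one_mem ⟨by norm_num, by linarith⟩) hle) ?_
  refine (cos_add_mul_sin_pi_sub _).trans_lt ?_
  obtain ⟨h1, h2⟩ := abs_cos_sin_sub_taylor_le (x := 0.343206) (by norm_num [abs_le])
  rw [abs_of_pos (by norm_num : (0 : ℝ) < 0.343206), abs_le] at h1 h2
  norm_num at h1 h2
  nlinarith [h1.1, h1.2, h2.1, h2.2]

/-- Inserting `cos s = -s * sin s` into `sin² + cos² = 1` gives `(l * sin s)² = 1`. Thus `cos t + t
/ l` vanishes together with its derivative at `s = √(l² - 1)`. -/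
theorem cos_sin_of_lambdaFun_eq_zero {l : ℝ} (h2 : 2 < l) (hp : l < Real.pi) (h0 : lambdaFun l = 0) :
    Real.pi / 2 < √(l ^ 2 - 1) ∧ √(l ^ 2 - 1) < Real.pi ∧ √(l ^ 2 - 1) < l ∧
      Real.cos √(l ^ 2 - 1) = -√(l ^ 2 - 1) / l ∧ Real.sin √(l ^ 2 - 1) = 1 / l := by
  have hs2 : √(l ^ 2 - 1) ^ 2 = l ^ 2 - 1 := Real.sq_sqrt (by nlinarith)
  set s := √(l ^ 2 - 1) with hs
  have a1 : Real.pi / 2 < s := by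
    apply Real.lt_sqrt_of_sq_lt
    nlinarith [Real.pi_lt_d2, Real.pi_pos]
  have hpos : 0 < s := by linarith [Real.pi_pos]
  have a3 : s < l := by nlinarith
  have a2 : s < Real.pi := a3.trans hp
  have hsin : 0 < Real.sin s := Real.sin_pos_of_pos_of_lt_pi hpos a2
  have h0' : Real.cos s + s * Real.sin s = 0 := h0
  have hsl : Real.sin s = 1 / l := by
    rw [eq_div_iff (by linarith)]
    have h4 : (Real.sin s * l) ^ 2 = 1 := by
      have := Real.sin_sq_add_cos_sq s
      have hc : Real.cos s = -(s * Real.sin s) := by linarith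
      rw [hc] at this
      nlinarith
    nlinarith [mul_pos hsin (show 0 < l by linarith)]
  refine ⟨a1, a2, a3, ?_, hsl⟩
  rw [hsl] at h0'
  have : s * (1 / l) = s / l := by ring
  rw [neg_div]
  linarith

/-! ### Coverings by disjoint half-lines, and reduction to `logDisk r`. -/

/-- `C` is the union of a family of pairwise disjoint half-lines. -/
def RayCoverable {V : Type*} [AddCommGroup V] [Module ℝ V] (C : Set V) : Prop :=
  ∃ S : Set (Set V), (∀ H ∈ S, ∃ z v : V, v ≠ 0 ∧
    (H = {p | ∃ t : ℝ, 0 < t ∧ p = t • v + z} ∨ H = {p | ∃ t : ℝ, 0 ≤ t ∧ p = t • v + z})) ∧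
    S.PairwiseDisjoint id ∧ ⋃₀ S = C

theorem isCloseToConvex_iff_rayCoverable {n : ℕ} (D : Set (EuclideanSpace ℝ (Fin n))) :
    IsCloseToConvex D ↔ RayCoverable Dᶜ := Iff.rfl

theorem RayCoverable.image {V W : Type*} [AddCommGroup V] [Module ℝ V] [AddCommGroup W]
    [Module ℝ W] (φ : V ≃ₗ[ℝ] W) {C : Set V} (h : RayCoverable C) : RayCoverable (φ '' C) := by
  obtain ⟨S, hS, hd, hu⟩ := h
  refine ⟨(fun H => φ '' H) '' S, ?_, ?_, ?_⟩
  · rintro _ ⟨H, hH, rfl⟩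
    obtain ⟨z, v, hv, h⟩ := hS H hH
    refine ⟨φ z, φ v, by simpa using hv, h.imp ?_ ?_⟩ <;>
    · rintro rfl
      ext p
      constructor
      · rintro ⟨_, ⟨t, ht, rfl⟩, rfl⟩
        exact ⟨t, ht, by simp⟩
      · rintro ⟨t, ht, rfl⟩
        exact ⟨t • v + z, ⟨t, ht, rfl⟩, by simp⟩
  · rintro _ ⟨H, hH, rfl⟩ _ ⟨K, hK, rfl⟩ hne
    have : H ≠ K := fun e => hne (by rw [e])
    exact (disjoint_image_iff φ.injective).2 (hd hH hK this)
  · rw [sUnion_image, ← hu, sUnion_eq_biUnion, image_iUnion₂]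

theorem rayCoverable_image_iff {V W : Type*} [AddCommGroup V] [Module ℝ V] [AddCommGroup W]
    [Module ℝ W] (φ : V ≃ₗ[ℝ] W) {C : Set V} : RayCoverable (φ '' C) ↔ RayCoverable C := by
  refine ⟨fun h => ?_, fun h => h.image φ⟩
  have := h.image φ.symm
  rwa [← image_comp, show (φ.symm ∘ φ : V → V) = id by ext; simp, image_id] at this

/-- Multiplication by `x` is real linear, maps `logDisk r` to the disk about `x`, and carries
half-lines to half-lines. -/
theorem isCloseToConvex_qhBall_iff {x : EuclideanSpace ℝ (Fin 2)} (hx : x ≠ 0) (r : ℝ) :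
    IsCloseToConvex (qhBall {0}ᶜ x r) ↔ RayCoverable (logDisk r)ᶜ := by
  obtain ⟨x, rfl⟩ := planeEquiv.surjective x
  have hx' : x ≠ 0 := by simpa using hx
  let φ : ℂ ≃ₗ[ℝ] EuclideanSpace ℝ (Fin 2) :=
    ((LinearEquiv.smulOfNeZero ℂ ℂ x hx').restrictScalars ℝ).trans planeEquiv.toLinearEquiv
  have hφ : ∀ z, φ z = planeEquiv (x * z) := fun z => rfl
  rw [isCloseToConvex_iff_rayCoverable, ← rayCoverable_image_iff φ]
  have : (qhBall {0}ᶜ (planeEquiv x) r)ᶜ = φ '' (logDisk r)ᶜ := by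
    rw [image_compl_eq φ.bijective]
    congr 1
    ext p
    obtain ⟨y, rfl⟩ := planeEquiv.surjective p
    rw [planeEquiv_mem_qhBall hx']
    constructor
    · intro h
      exact ⟨y / x, h, by rw [hφ, mul_div_cancel₀ _ hx']⟩
    · rintro ⟨z, hz, hzy⟩
      rw [hφ] at hzy
      rwa [← planeEquiv.injective hzy, mul_div_cancel_left₀ _ hx']
  rw [this]

theorem IsLowerSet.eq_Iio_or_eq_Iic {L : Set ℝ} (hl : IsLowerSet L) (hne : L.Nonempty)
    (hb : BddAbove L) : L = Iio (sSup L) ∨ L = Iic (sSup L) := by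
  by_cases h : sSup L ∈ L
  · exact Or.inr (Subset.antisymm (fun t ht => le_csSup hb ht) fun t ht => hl ht h)
  · refine Or.inl (Subset.antisymm (fun t ht => lt_of_le_of_ne (le_csSup hb ht) ?_) fun t ht => ?_)
    · rintro rfl; exact h ht
    · obtain ⟨u, hu, htu⟩ := exists_lt_of_lt_csSup hne ht
      exact hl htu.le hu

theorem IsUpperSet.eq_Ioi_or_eq_Ici {L : Set ℝ} (hl : IsUpperSet L) (hne : L.Nonempty)
    (hb : BddBelow L) : L = Ioi (sInf L) ∨ L = Ici (sInf L) := by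
  by_cases h : sInf L ∈ L
  · exact Or.inr (Subset.antisymm (fun t ht => csInf_le hb ht) fun t ht => hl ht h)
  · refine Or.inl (Subset.antisymm (fun t ht => lt_of_le_of_ne (csInf_le hb ht) ?_) fun t ht => ?_)
    · rintro rfl; exact h ht
    · obtain ⟨u, hu, htu⟩ := exists_lt_of_csInf_lt hne ht
      exact hl htu.le hu

/-- The complement of a bounded interval consists of two disjoint half-lines. -/
theorem Set.OrdConnected.exists_compl_eq_union {I : Set ℝ} (hI : I.OrdConnected) {M : ℝ}
    (hM : ∀ t ∈ I, |t| ≤ M) :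
    ∃ L R : Set ℝ, (∃ a, L = Iio a ∨ L = Iic a) ∧ (∃ b, R = Ioi b ∨ R = Ici b) ∧
      Disjoint L R ∧ L ∪ R = Iᶜ := by
  rcases I.eq_empty_or_nonempty with rfl | ⟨i, hi⟩
  · exact ⟨Iio 0, Ici 0, ⟨0, Or.inl rfl⟩, ⟨0, Or.inr rfl⟩,
      (Iio_disjoint_Ici le_rfl), by simp⟩
  -- The two half-lines are the strict lower and the strict upper bounds of `I`.
  refine ⟨{t | ∀ j ∈ I, t < j}, {t | ∀ j ∈ I, j < t},
    ⟨_, IsLowerSet.eq_Iio_or_eq_Iic (fun a b hab ha j hj => hab.trans_lt (ha j hj))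
      ⟨-M - 1, fun j hj => ?_⟩ ⟨i, fun t ht => (ht i hi).le⟩⟩,
    ⟨_, IsUpperSet.eq_Ioi_or_eq_Ici (fun a b hab ha j hj => (ha j hj).trans_le hab)
      ⟨M + 1, fun j hj => ?_⟩ ⟨i, fun t ht => (ht i hi).le⟩⟩, ?_, ?_⟩
  · linarith [(abs_le.1 (hM j hj)).1]
  · linarith [(abs_le.1 (hM j hj)).2]
  · exact disjoint_left.2 fun t h1 h2 => lt_asymm (h1 i hi) (h2 i hi)
  · ext t
    constructor
    · rintro (h | h) ht
      · exact lt_irrefl _ (h t ht)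
      · exact lt_irrefl _ (h t ht)
    · intro ht
      by_contra hc
      simp only [mem_union, mem_ofPred_eq, not_or, not_forall, not_lt] at hc
      obtain ⟨⟨j, hj, hjt⟩, ⟨k, hk, htk⟩⟩ := hc
      exact ht (hI.out hj hk ⟨hjt, htk⟩)

/-- A bounded plane set all of whose horizontal sections are intervals has a complement that is
a union of disjoint horizontal half-lines. -/
theorem rayCoverable_compl_of_ordConnected {D : Set ℂ} {M : ℝ} (hM : ∀ z ∈ D, |z.re| ≤ M)
    (hD : ∀ c : ℝ, OrdConnected {t : ℝ | (⟨t, c⟩ : ℂ) ∈ D}) : RayCoverable Dᶜ := by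
  choose L R hL hR hLR hU using fun c => (hD c).exists_compl_eq_union (fun t ht => hM _ ht)
  have hsec : ∀ z : ℂ, z ∈ Dᶜ ↔ z.re ∈ L z.im ∪ R z.im := fun z => by
    rw [hU]; rfl
  refine ⟨range (fun c => {z : ℂ | z.im = c ∧ z.re ∈ L c}) ∪
    range (fun c => {z : ℂ | z.im = c ∧ z.re ∈ R c}), ?_, ?_, ?_⟩
  · rintro _ (⟨c, rfl⟩ | ⟨c, rfl⟩)
    · obtain ⟨a, ha⟩ := hL c
      refine ⟨⟨a, c⟩, -1, by simp, ha.imp ?_ ?_⟩ <;>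
      · intro h
        ext z
        simp only [h, mem_ofPred_eq, mem_Iio, mem_Iic]
        constructor
        · rintro ⟨h1, h2⟩
          exact ⟨a - z.re, by linarith, by apply Complex.ext <;> simp [h1]⟩
        · rintro ⟨t, ht, rfl⟩
          simp [ht]
    · obtain ⟨a, ha⟩ := hR c
      refine ⟨⟨a, c⟩, 1, by simp, ha.imp ?_ ?_⟩ <;>
      · intro h
        ext z
        simp only [h, mem_ofPred_eq, mem_Ioi, mem_Ici]
        constructor
        · rintro ⟨h1, h2⟩
          exact ⟨z.re - a, by linarith, by apply Complex.ext <;> simp [h1]⟩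
        · rintro ⟨t, ht, rfl⟩
          simp [ht]
  · have hx : ∀ c t, t ∈ L c → t ∈ R c → False := fun c t h1 h2 => disjoint_left.1 (hLR c) h1 h2
    rintro _ (⟨c, rfl⟩ | ⟨c, rfl⟩) _ (⟨d, rfl⟩ | ⟨d, rfl⟩) hne
    all_goals
      refine disjoint_left.2 ?_
      rintro z ⟨h1, h2⟩ ⟨h3, h4⟩
      have hcd : c = d := h1.symm.trans h3
      subst hcd
    · exact hne rfl
    · exact hx _ _ h2 h4
    · exact hx _ _ h4 h2
    · exact hne rfl
  · ext z
    rw [hsec, mem_sUnion]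
    constructor
    · rintro ⟨_, ⟨c, rfl⟩ | ⟨c, rfl⟩, h1, h2⟩
      · exact Or.inl (h1 ▸ h2)
      · exact Or.inr (h1 ▸ h2)
    · rintro (h | h)
      · exact ⟨_, Or.inl ⟨z.im, rfl⟩, rfl, h⟩
      · exact ⟨_, Or.inr ⟨z.im, rfl⟩, rfl, h⟩

/-! ### Small radii: horizontal sections are intervals. -/

theorem mem_logDisk_iff {r : ℝ} (hr : 0 < r) {z : ℂ} :
    z ∈ logDisk r ↔ z ≠ 0 ∧ Real.log ‖z‖ ^ 2 + Complex.arg z ^ 2 < r ^ 2 := by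
  have h : ‖Complex.log z‖ ^ 2 = Real.log ‖z‖ ^ 2 + Complex.arg z ^ 2 := by
    rw [← Complex.normSq_eq_norm_sq, Complex.normSq_apply, Complex.log_re, Complex.log_im]
    ring
  rw [logDisk, mem_ofPred_eq, ← h, sq_lt_sq₀ (norm_nonneg _) hr.le]

theorem conj_mem_logDisk_iff {r : ℝ} (hr : 0 < r) {z : ℂ} :
    (starRingEnd ℂ) z ∈ logDisk r ↔ z ∈ logDisk r := by
  rw [mem_logDisk_iff hr, mem_logDisk_iff hr, Complex.norm_conj, Complex.arg_conj]
  split_ifs with h <;> simp [h]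

theorem arg_mem_Ioo_of_im_pos {z : ℂ} (hz : 0 < z.im) : Complex.arg z ∈ Ioo 0 Real.pi := by
  have h1 := Complex.norm_mul_sin_arg z
  have h2 : 0 ≤ Complex.arg z := Complex.arg_nonneg_iff.2 hz.le
  refine ⟨lt_of_le_of_ne h2 fun h => ?_, lt_of_le_of_ne (Complex.arg_le_pi z) fun h => ?_⟩
  · rw [← h, Real.sin_zero] at h1; linarith
  · rw [h, Real.sin_pi] at h1; linarith

/-- On the horizontal line at height `c` the logarithm of the modulus is `log c - log (sin θ)`, so
this makes it a convex function of the argument. -/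
theorem concaveOn_log_sin : ConcaveOn ℝ (Ioo 0 Real.pi) fun θ => Real.log (Real.sin θ) := by
  refine ⟨convex_Ioo _ _, fun x hx y hy a b ha hb hab => ?_⟩
  have h1 := Real.sin_pos_of_mem_Ioo hx
  have h2 := Real.sin_pos_of_mem_Ioo hy
  have h3 : a • Real.sin x + b • Real.sin y ≤ Real.sin (a • x + b • y) :=
    strictConcaveOn_sin_Icc.concaveOn.2 (Ioo_subset_Icc_self hx) (Ioo_subset_Icc_self hy) ha hb hab
  refine (strictConcaveOn_log_Ioi.concaveOn.2 h1 h2 ha hb hab).trans (Real.log_le_log ?_ h3)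
  exact (convex_Ioi (0 : ℝ)) h1 h2 ha hb hab

/-- The function is the logarithm of the height of the inner boundary point of `logDisk r` at
argument `θ`; the sign of its derivative decides close-to-convexity. -/
theorem hasDerivAt_log_sin_sub_sqrt {r θ : ℝ} (h0 : 0 < θ) (hr : θ < r) (hp : θ < Real.pi) :
    HasDerivAt (fun θ => Real.log (Real.sin θ) - √(r ^ 2 - θ ^ 2))
      (Real.cos θ / Real.sin θ + θ / √(r ^ 2 - θ ^ 2)) θ := by
  have hs := Real.sin_pos_of_pos_of_lt_pi h0 hp
  have hq : 0 < r ^ 2 - θ ^ 2 := by nlinarith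
  have h1 := (Real.hasDerivAt_sin θ).log hs.ne'
  have h2 := ((hasDerivAt_pow 2 θ).const_sub (r ^ 2)).sqrt hq.ne'
  have hq' := Real.sqrt_pos.2 hq
  refine (h1.sub h2).congr_deriv ?_
  field_simp
  push_cast
  ring

/-- Where `cos θ < 0`, the derivative is nonnegative exactly if `cos² θ * (r² - θ²) ≤ sin² θ * θ²`,
that is, `r² * cos² θ ≤ θ²`. -/
theorem monotoneOn_log_sin_sub_sqrt {r : ℝ} (hr : 0 < r) (hrp : r ≤ Real.pi)
    (hcos : ∀ θ ∈ Ioo 0 r, -(θ / r) ≤ Real.cos θ) :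
    MonotoneOn (fun θ => Real.log (Real.sin θ) - √(r ^ 2 - θ ^ 2)) (Ioo 0 r) := by
  have hd := fun θ (hθ : θ ∈ Ioo 0 r) =>
    hasDerivAt_log_sin_sub_sqrt hθ.1 hθ.2 (hθ.2.trans_le hrp)
  refine monotoneOn_of_deriv_nonneg (convex_Ioo _ _)
    (fun θ hθ => (hd θ hθ).continuousAt.continuousWithinAt)
    (fun θ hθ => (hd θ (interior_subset hθ)).differentiableAt.differentiableWithinAt)
    fun θ hθ => ?_
  have hθ := interior_subset hθ
  rw [(hd θ hθ).deriv]
  have hs := Real.sin_pos_of_pos_of_lt_pi hθ.1 (hθ.2.trans_le hrp)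
  have hq : 0 < r ^ 2 - θ ^ 2 := by nlinarith [hθ.1, hθ.2]
  have hq' := Real.sqrt_pos.2 hq
  rw [div_add_div _ _ hs.ne' hq'.ne']
  refine div_nonneg ?_ (mul_pos hs hq').le
  rcases le_or_gt 0 (Real.cos θ) with hc | hc
  · exact add_nonneg (mul_nonneg hc hq'.le) (mul_nonneg hs.le hθ.1.le)
  · have h1 := hcos θ hθ
    have h2 : -(r * Real.cos θ) ≤ θ := by
      have : r * -(θ / r) = -θ := by field_simp
      nlinarith [mul_le_mul_of_nonneg_left h1 hr.le]
    have h3 : (r * Real.cos θ) ^ 2 ≤ θ ^ 2 := by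
      rw [← neg_sq]
      have : 0 ≤ -(r * Real.cos θ) := by nlinarith
      gcongr
    have h4 : (-Real.cos θ * √(r ^ 2 - θ ^ 2)) ^ 2 ≤ (Real.sin θ * θ) ^ 2 := by
      rw [mul_pow, Real.sq_sqrt hq.le, mul_pow, Real.sin_sq]
      nlinarith
    have h5 := (sq_le_sq₀ (mul_nonneg (by linarith) hq'.le) (mul_pos hs hθ.1).le).1 h4
    linarith

/-- A middle point of modulus at least one is controlled by convexity of the log-modulus in the
argument. A middle point inside the unit disk is controlled by the left point, of larger argument,
because the inner boundary rises with the argument. -/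
theorem mem_logDisk_of_between {r : ℝ} (hr : 0 < r) (hrp : r ≤ Real.pi)
    (hcos : ∀ θ ∈ Ioo 0 r, -(θ / r) ≤ Real.cos θ) {c t₁ t₂ t₃ : ℝ} (hc : 0 < c)
    (h₁ : (⟨t₁, c⟩ : ℂ) ∈ logDisk r) (h₃ : (⟨t₃, c⟩ : ℂ) ∈ logDisk r) (h₁₂ : t₁ ≤ t₂)
    (h₂₃ : t₂ ≤ t₃) : (⟨t₂, c⟩ : ℂ) ∈ logDisk r := by
  set θ : ℝ → ℝ := fun t => Complex.arg ⟨t, c⟩ with hθ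
  have hθm : ∀ t, θ t ∈ Ioo 0 Real.pi := fun t => arg_mem_Ioo_of_im_pos hc
  have hsin : ∀ t, 0 < Real.sin (θ t) := fun t => Real.sin_pos_of_mem_Ioo (hθm t)
  have hne : ∀ t, (⟨t, c⟩ : ℂ) ≠ 0 := fun t h => hc.ne' (congrArg Complex.im h)
  have him : ∀ t, ‖(⟨t, c⟩ : ℂ)‖ * Real.sin (θ t) = c := fun t => Complex.norm_mul_sin_arg _
  have hre : ∀ t, ‖(⟨t, c⟩ : ℂ)‖ * Real.cos (θ t) = t := fun t => Complex.norm_mul_cos_arg _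
  have hlog : ∀ t, Real.log ‖(⟨t, c⟩ : ℂ)‖ = Real.log c - Real.log (Real.sin (θ t)) := by
    intro t
    rw [← him t, Real.log_mul (norm_ne_zero_iff.2 (hne t)) (hsin t).ne']
    simp [him t]
  have hanti : ∀ s t, s ≤ t → θ t ≤ θ s := by
    intro s t hst
    by_contra! hlt
    have h0 : 0 < Real.sin (θ t - θ s) :=
      Real.sin_pos_of_pos_of_lt_pi (by linarith) (by linarith [(hθm t).2, (hθm s).1])
    -- Both sides are the imaginary part of the conjugate of `s + ic` times `t + ic`.
    have e : c * (s - t) = ‖(⟨t, c⟩ : ℂ)‖ * ‖(⟨s, c⟩ : ℂ)‖ * Real.sin (θ t - θ s) := by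
      rw [Real.sin_sub]
      linear_combination (-s) * him t + (t) * him s -
        ‖(⟨t, c⟩ : ℂ)‖ * Real.sin (θ t) * hre s + ‖(⟨s, c⟩ : ℂ)‖ * Real.sin (θ s) * hre t
    have : 0 < c * (s - t) := by
      rw [e]
      exact mul_pos (mul_pos (norm_pos_iff.2 (hne t)) (norm_pos_iff.2 (hne s))) h0
    nlinarith
  have hmem : ∀ t, (⟨t, c⟩ : ℂ) ∈ logDisk r ↔
      (Real.log c - Real.log (Real.sin (θ t))) ^ 2 + θ t ^ 2 < r ^ 2 := by
    intro t
    rw [mem_logDisk_iff hr, hlog, and_iff_right (hne t)]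
  rw [hmem] at h₁ h₃ ⊢
  have m₂ : θ t₂ ∈ segment ℝ (θ t₃) (θ t₁) := by
    rw [segment_eq_Icc (hanti _ _ (h₁₂.trans h₂₃))]
    exact ⟨hanti _ _ h₂₃, hanti _ _ h₁₂⟩
  obtain ⟨a, b, ha, hb, hab, he⟩ := m₂
  have hconc := concaveOn_log_sin.2 (hθm t₃) (hθm t₁) ha hb hab
  simp only [smul_eq_mul] at hconc he
  rw [he] at hconc
  have hθr : ∀ t, (Real.log c - Real.log (Real.sin (θ t))) ^ 2 + θ t ^ 2 < r ^ 2 →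
      θ t ∈ Ioo 0 r := by
    intro t h
    have := sq_nonneg (Real.log c - Real.log (Real.sin (θ t)))
    exact ⟨(hθm t).1, by nlinarith [(hθm t).1]⟩
  have hθ1 := hθr _ h₁
  have hθ2 : θ t₂ ∈ Ioo 0 r := ⟨(hθm t₂).1, (hanti _ _ h₁₂).trans_lt hθ1.2⟩
  have hmono := monotoneOn_log_sin_sub_sqrt hr hrp hcos hθ2 hθ1 (hanti _ _ h₁₂)
  simp only at hmono
  generalize Real.log (Real.sin (θ t₁)) = u₁ at *
  generalize Real.log (Real.sin (θ t₂)) = u₂ at *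
  generalize Real.log (Real.sin (θ t₃)) = u₃ at *
  generalize Real.log c = k at *
  rcases le_or_gt 0 (k - u₂) with hpos | hneg
  · have hb' : b = 1 - a := by linarith
    have h5 : k - u₂ ≤ a * (k - u₃) + b * (k - u₁) := by subst hb'; linarith
    have h6 : (k - u₂) ^ 2 ≤ (a * (k - u₃) + b * (k - u₁)) ^ 2 := by gcongr
    have conv : ∀ p q : ℝ, (a * p + b * q) ^ 2 ≤ a * p ^ 2 + b * q ^ 2 := by
      intro p q
      subst hb'
      nlinarith [mul_nonneg (mul_nonneg ha hb) (sq_nonneg (p - q))]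
    have h7 := conv (k - u₃) (k - u₁)
    have h8 := conv (θ t₃) (θ t₁)
    rw [he] at h8
    have h9 : a * ((k - u₃) ^ 2 + θ t₃ ^ 2) + b * ((k - u₁) ^ 2 + θ t₁ ^ 2) < r ^ 2 := by
      have := (convex_Iio (r ^ 2)) h₃ h₁ ha hb hab
      simpa using this
    linarith
  · have h5 : -(k - u₁) < √(r ^ 2 - θ t₁ ^ 2) := by
      refine lt_of_le_of_lt (neg_le_abs _) (Real.lt_sqrt_of_sq_lt ?_)
      rw [sq_abs]; linarith
    have h6 : -(k - u₂) < √(r ^ 2 - θ t₂ ^ 2) := by linarith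
    have h7 := (Real.lt_sqrt (by linarith)).1 h6
    rw [neg_sq] at h7
    linarith

theorem rayCoverable_compl_logDisk {r : ℝ} (hr : 0 < r) (hrp : r ≤ Real.pi)
    (hcos : ∀ θ ∈ Ioo 0 r, -(θ / r) ≤ Real.cos θ) : RayCoverable (logDisk r)ᶜ := by
  refine rayCoverable_compl_of_ordConnected (M := Real.exp r) (fun z hz => ?_) fun c => ?_
  · refine (Complex.abs_re_le_norm z).trans ?_
    rw [← Real.exp_log (norm_pos_iff.2 hz.1)]
    refine Real.exp_le_exp.2 ?_
    have := (Complex.abs_re_le_norm (Complex.log z)).trans hz.2.le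
    rw [Complex.log_re] at this
    exact (le_abs_self _).trans this
  · refine ⟨fun t₁ h₁ t₃ h₃ t₂ h₂ => ?_⟩
    rcases lt_trichotomy c 0 with hc | rfl | hc
    · have e : ∀ t : ℝ, (⟨t, c⟩ : ℂ) = (starRingEnd ℂ) ⟨t, -c⟩ := fun t => by
        apply Complex.ext <;> simp
      simp only [mem_ofPred_eq, e, conj_mem_logDisk_iff hr] at h₁ h₃ ⊢
      exact mem_logDisk_of_between hr hrp hcos (neg_pos.2 hc) h₁ h₃ h₂.1 h₂.2
    · have e : ∀ t : ℝ, (⟨t, 0⟩ : ℂ) ∈ logDisk r ↔ 0 < t ∧ Real.log t ^ 2 < r ^ 2 := by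
        intro t
        have e1 : (⟨t, 0⟩ : ℂ) = (t : ℂ) := rfl
        rw [mem_logDisk_iff hr, e1, Complex.norm_real, Real.norm_eq_abs, Real.log_abs]
        rcases lt_trichotomy t 0 with ht | rfl | ht
        · rw [Complex.arg_ofReal_of_neg ht]
          refine ⟨fun h => ?_, fun h => absurd h.1 (not_lt.2 ht.le)⟩
          nlinarith [h.2, sq_nonneg (Real.log t)]
        · simp
        · rw [Complex.arg_ofReal_of_nonneg ht.le]
          simp [ht, ht.ne']
      simp only [mem_ofPred_eq, e, sq_lt_sq, abs_of_pos hr, abs_lt] at h₁ h₃ ⊢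
      have h0 := h₁.1.trans_le h₂.1
      exact ⟨h0, h₁.2.1.trans_le (Real.log_le_log h₁.1 h₂.1),
        (Real.log_le_log h0 h₂.2).trans_lt h₃.2.2⟩
    · exact mem_logDisk_of_between hr hrp hcos hc h₁ h₃ h₂.1 h₂.2

/-! ### Large radii: the neck forces half-lines to cross. -/

theorem exists_norm_add_smul_eq_one {p v : ℂ} (hp : ‖p‖ < 1) (hv : v ≠ 0) :
    ∃ t : ℝ, 0 < t ∧ ‖p + t • v‖ = 1 := by
  have hv' : 0 < ‖v‖ := norm_pos_iff.2 hv
  have hT : (0 : ℝ) ≤ 2 / ‖v‖ := by positivity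
  have hc : ContinuousOn (fun t : ℝ => ‖p + t • v‖) (Icc 0 (2 / ‖v‖)) := by fun_prop
  have h1 : 1 ∈ Icc ‖p + (0 : ℝ) • v‖ ‖p + (2 / ‖v‖) • v‖ := by
    refine ⟨by simpa using hp.le, ?_⟩
    have h2 : ‖(2 / ‖v‖) • v‖ = 2 := by
      rw [norm_smul, Real.norm_of_nonneg hT]; field_simp
    have h3 := norm_sub_le (p + (2 / ‖v‖) • v) p
    rw [add_sub_cancel_left, h2] at h3
    linarith
  obtain ⟨t, ht, he⟩ := intermediate_value_Icc hT hc h1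
  refine ⟨t, lt_of_le_of_ne ht.1 ?_, he⟩
  rintro rfl
  simp only [zero_smul, add_zero] at he
  exact hp.ne he

/-- A half-line that starts inside the unit disk, above the neck of the complement of `logDisk r`
at angle `s`, and stays in that complement, points to the lower left. -/
theorem direction_of_ray_avoiding_logDisk {r s : ℝ} (hs : 0 < s) (hsp : s < Real.pi) (hsr : s < r)
    {p v : ℂ} (hp1 : ‖p‖ < 1) (him : 0 < p.im) (hps : Complex.arg p < s)
    (hph : Real.pi / 2 ≤ Complex.arg p)
    (hneck : Real.log (Real.sin s) - √(r ^ 2 - s ^ 2) < Real.log p.im) (hv : v ≠ 0)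
    (hray : ∀ t : ℝ, 0 ≤ t → p + t • v ∉ logDisk r) : v.re < 0 ∧ v.im < 0 := by
  have hr : 0 < r := hs.trans hsr
  obtain ⟨t, ht, hE⟩ := exists_norm_add_smul_eq_one hp1 hv
  set E := p + t • v with hEdef
  have hE0 : E ≠ 0 := norm_ne_zero_iff.1 (by rw [hE]; exact one_ne_zero)
  have hEr : r ≤ |Complex.arg E| := by
    by_contra! h
    refine hray t ht.le ((mem_logDisk_iff hr).2 ⟨hE0, ?_⟩)
    rw [← hEdef, hE, Real.log_one, ← sq_abs (Complex.arg E)]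
    have := abs_nonneg (Complex.arg E)
    nlinarith
  have hEre : E.re = Real.cos |Complex.arg E| := by
    have := Complex.norm_mul_cos_arg E
    rw [hE, one_mul] at this
    rw [Real.cos_abs, this]
  have hEim : E.im = Real.sin (Complex.arg E) := by
    have := Complex.norm_mul_sin_arg E
    rw [hE, one_mul] at this
    exact this.symm
  have hpre := Complex.norm_mul_cos_arg p
  have hpim := Complex.norm_mul_sin_arg p
  have hcos : Real.cos (Complex.arg p) ≤ 0 :=
    Real.cos_nonpos_of_pi_div_two_le_of_le hph (by linarith)
  have hargp : 0 < Complex.arg p := by linarith [Real.pi_pos]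
  -- `E` lies on the unit circle outside the disk, so `|arg E| ≥ r > s > arg p`: it is further left
  -- than `p`.
  have hre : E.re < p.re := by
    rw [hEre, ← hpre]
    have h1 : Real.cos |Complex.arg E| < Real.cos (Complex.arg p) :=
      Real.cos_lt_cos_of_nonneg_of_le_pi hargp.le (Complex.abs_arg_le_pi E) (by linarith)
    nlinarith
  have hEre' : E.re = p.re + t * v.re := by simp [hEdef]
  have hEim' : E.im = p.im + t * v.im := by simp [hEdef]
  refine ⟨by nlinarith, ?_⟩
  by_contra! hvim
  have hEpos : 0 < E.im := by nlinarith [mul_nonneg ht.le hvim]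
  have hEarg := arg_mem_Ioo_of_im_pos hEpos
  rw [abs_of_pos hEarg.1] at hEr
  have hsin : 0 < Real.sin s := Real.sin_pos_of_pos_of_lt_pi hs hsp
  have hp0 : 0 < ‖p‖ := norm_pos_iff.2 (fun h => by simp [h] at him)
  -- the linear form `z ↦ z.re * sin s - z.im * cos s` changes sign between `p` and `E`
  have hLp : 0 < p.re * Real.sin s - p.im * Real.cos s := by
    have : p.re * Real.sin s - p.im * Real.cos s = ‖p‖ * Real.sin (s - Complex.arg p) := by
      rw [Real.sin_sub]
      linear_combination (-Real.sin s) * hpre + Real.cos s * hpim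
    rw [this]
    exact mul_pos hp0 (Real.sin_pos_of_pos_of_lt_pi (by linarith) (by linarith))
  have hLE : E.re * Real.sin s - E.im * Real.cos s < 0 := by
    have : E.re * Real.sin s - E.im * Real.cos s = -Real.sin (Complex.arg E - s) := by
      rw [Real.sin_sub, hEre, hEim, Real.cos_abs]; ring
    rw [this]
    exact neg_neg_of_pos (Real.sin_pos_of_pos_of_lt_pi (by linarith) (by linarith [hEarg.2]))
  have hc : ContinuousOn (fun u : ℝ => (p + u • v).re * Real.sin s - (p + u • v).im * Real.cos s)
      (Icc 0 t) := by
    simp only [Complex.add_re, Complex.add_im, Complex.smul_re, Complex.smul_im, smul_eq_mul]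
    fun_prop
  -- If the ray did not descend, it would cross the ray `arg = s` at a point `Q` of the closed unit
  -- disk at least as high as `p`. By `hneck` that is above the inner boundary at `s`, so `Q` would
  -- lie in `logDisk r`.
  obtain ⟨u, hu, hQ⟩ := intermediate_value_Icc' ht.le hc ⟨hLE.le, by simpa using hLp.le⟩
  set Q := p + u • v with hQdef
  have hQim' : Q.im = p.im + u * v.im := by simp [hQdef]
  have hQim : p.im ≤ Q.im := by nlinarith [mul_nonneg hu.1 hvim]
  have hQpos : 0 < Q.im := him.trans_le hQim
  have hQnorm : ‖Q‖ ≤ 1 := by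
    have hseg : Q ∈ segment ℝ p E := by
      refine ⟨1 - u / t, u / t, by rw [sub_nonneg, div_le_one ht]; exact hu.2,
        div_nonneg hu.1 ht.le, by ring, ?_⟩
      rw [hEdef, smul_add, smul_smul, div_mul_cancel₀ _ ht.ne', ← add_assoc, ← add_smul]
      simp [hQdef]
    have := (convex_closedBall (0 : ℂ) 1).segment_subset (by simpa using hp1.le)
      (by simpa using hE.le) hseg
    simpa using this
  set m := Q.im / Real.sin s with hm
  have hmpos : 0 < m := div_pos hQpos hsin
  have hQeq : Q = (m : ℂ) * (Complex.cos s + Complex.sin s * Complex.I) := by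
    change Q.re * Real.sin s - Q.im * Real.cos s = 0 at hQ
    clear_value Q
    rw [← Complex.ofReal_cos, ← Complex.ofReal_sin]
    apply Complex.ext
    · rw [Complex.re_ofReal_mul, Complex.add_re, Complex.ofReal_re, Complex.re_ofReal_mul,
        Complex.I_re, hm]
      field_simp
      linarith
    · rw [Complex.im_ofReal_mul, Complex.add_im, Complex.ofReal_im, Complex.im_ofReal_mul,
        Complex.I_im, hm]
      field_simp
      ring
  have hQarg : Complex.arg Q = s := by
    rw [hQeq]
    exact Complex.arg_mul_cos_add_sin_mul_I hmpos ⟨by linarith, hsp.le⟩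
  have hQm : ‖Q‖ * Real.sin s = Q.im := by rw [← hQarg]; exact Complex.norm_mul_sin_arg Q
  have hQn0 : 0 < ‖Q‖ := norm_pos_iff.2 (fun h => by simp [h] at hQpos)
  have hlog : Real.log Q.im = Real.log ‖Q‖ + Real.log (Real.sin s) := by
    rw [← hQm, Real.log_mul hQn0.ne' hsin.ne']
  have h1 : Real.log p.im ≤ Real.log Q.im := Real.log_le_log him hQim
  have h2 : Real.log ‖Q‖ ≤ 0 := Real.log_nonpos hQn0.le hQnorm
  have h3 : -Real.log ‖Q‖ < √(r ^ 2 - s ^ 2) := by linarith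
  have h4 := (Real.lt_sqrt (by linarith)).1 h3
  refine hray u hu.1 ((mem_logDisk_iff hr).2 ⟨norm_pos_iff.1 hQn0, ?_⟩)
  rw [← hQdef, hQarg]
  linarith [neg_sq (Real.log ‖Q‖)]

theorem exists_gt_left_of_hasDerivAt_neg {f : ℝ → ℝ} {f' a b : ℝ} (hab : a < b)
    (hf : HasDerivAt f f' b) (hneg : f' < 0) : ∃ c ∈ Ioo a b, f b < f c := by
  have h1 := (hasDerivAt_iff_tendsto_slope.1 hf).mono_left
    (nhdsWithin_mono b (fun x (hx : x < b) => hx.ne) : 𝓝[<] b ≤ 𝓝[≠] b)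
  obtain ⟨c, hc, hcm⟩ := ((h1.eventually_lt_const hneg).and (Ioo_mem_nhdsLT hab)).exists
  refine ⟨c, hcm, ?_⟩
  rw [slope_def_field, div_neg_iff] at hc
  rcases hc with h | h <;> linarith [h.1, h.2, hcm.2]

/-- Two half-lines from conjugate points, pointing to the lower and the upper left, meet. -/
theorem exists_common_point_of_rays {p v w : ℂ} (hp : 0 < p.im) (hv : v.re < 0 ∧ v.im < 0)
    (hw : w.re < 0 ∧ 0 < w.im) : ∃ t u : ℝ, 0 ≤ t ∧ 0 ≤ u ∧
      p + t • v = (starRingEnd ℂ) p + u • w := by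
  have hd : 0 < v.re * -w.im + w.re * v.im := by
    nlinarith [mul_pos (neg_pos.2 hv.1) hw.2, mul_pos (neg_pos.2 hw.1) (neg_pos.2 hv.2)]
  -- Equal real parts make `t`, `u` proportional to `-w.re`, `-v.re`; `k` is fixed by the imaginary
  -- parts.
  set k := 2 * p.im / (v.re * -w.im + w.re * v.im) with hk
  have hkpos : 0 < k := div_pos (by linarith) hd
  have hkd : k * (v.re * -w.im + w.re * v.im) = 2 * p.im := div_mul_cancel₀ _ hd.ne'
  refine ⟨k * -w.re, k * -v.re, (mul_pos hkpos (neg_pos.2 hw.1)).le,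
    (mul_pos hkpos (neg_pos.2 hv.1)).le, ?_⟩
  apply Complex.ext
  · simp; ring
  · simp; linarith

theorem not_rayCoverable_of_rays {C : Set ℂ} {p : ℂ} (hp : 0 < p.im) (hpC : p ∈ C)
    (hqC : (starRingEnd ℂ) p ∈ C)
    (hdir : ∀ v : ℂ, v ≠ 0 → (∀ t : ℝ, 0 ≤ t → p + t • v ∈ C) → v.re < 0 ∧ v.im < 0)
    (hdir' : ∀ v : ℂ, v ≠ 0 → (∀ t : ℝ, 0 ≤ t → (starRingEnd ℂ) p + t • v ∈ C) →
      v.re < 0 ∧ 0 < v.im) : ¬ RayCoverable C := by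
  rintro ⟨S, hS, hdis, rfl⟩
  have hray : ∀ H ∈ S, ∃ v : ℂ, v ≠ 0 ∧ (∀ q ∈ H, ∀ t : ℝ, 0 ≤ t → q + t • v ∈ H) ∧
      ∀ q ∈ H, ∀ q' ∈ H, ∃ t : ℝ, q' - q = t • v := by
    intro H hH
    obtain ⟨z, v, hv, h | h⟩ := hS H hH <;>
    · subst h
      refine ⟨v, hv, ?_, ?_⟩
      · rintro _ ⟨a, ha, rfl⟩ t ht
        exact ⟨a + t, by linarith, by module⟩
      · rintro _ ⟨a, ha, rfl⟩ _ ⟨b, hb, rfl⟩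
        exact ⟨b - a, by module⟩
  obtain ⟨H, hH, hpH⟩ := hpC
  obtain ⟨K, hK, hqK⟩ := hqC
  obtain ⟨v, hv, hvH, hlin⟩ := hray H hH
  obtain ⟨w, hw, hwK, -⟩ := hray K hK
  have hvd := hdir v hv fun t ht => ⟨H, hH, hvH p hpH t ht⟩
  have hwd := hdir' w hw fun t ht => ⟨K, hK, hwK _ hqK t ht⟩
  obtain ⟨t, u, ht, hu, he⟩ := exists_common_point_of_rays hp hvd hwd
  -- The half-lines meet, so they coincide; one containing both `p` and its conjugate is vertical,
  -- contrary to `v.re < 0`.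
  have hHK : H = K := by
    by_contra hne
    exact disjoint_left.1 (hdis hH hK hne) (hvH p hpH t ht) (he ▸ hwK _ hqK u hu)
  subst hHK
  obtain ⟨a, ha⟩ := hlin p hpH _ hqK
  have h1 := congrArg Complex.re ha
  have h2 := congrArg Complex.im ha
  simp at h1 h2
  rcases h1 with h1 | h1
  · rw [h1] at h2; linarith
  · linarith [hvd.1]

/-- For `r > l` the derivative of the logarithmic height of the inner boundary at `s` is negative,
since `l * sin s = √(l² - s²) < √(r² - s²)`. A boundary point `p` at some `θ` slightly before `s` is
therefore higher than the neck, and `p` and its conjugate force two half-lines to cross. -/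
theorem not_rayCoverable_compl_logDisk {l s r : ℝ} (hsh : Real.pi / 2 < s) (hsp : s < Real.pi)
    (hsl : s < l) (hcos : Real.cos s = -s / l) (hlr : l < r) : ¬ RayCoverable (logDisk r)ᶜ := by
  have hs : 0 < s := by linarith [Real.pi_pos]
  have hl : 0 < l := hs.trans hsl
  have hr : 0 < r := hl.trans hlr
  have hsr : s < r := hsl.trans hlr
  have hsin : 0 < Real.sin s := Real.sin_pos_of_pos_of_lt_pi hs hsp
  have hq : 0 < r ^ 2 - s ^ 2 := by nlinarith
  have hq' := Real.sqrt_pos.2 hq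
  have hneg : Real.cos s / Real.sin s + s / √(r ^ 2 - s ^ 2) < 0 := by
    have h1 : l * Real.sin s < √(r ^ 2 - s ^ 2) := by
      apply Real.lt_sqrt_of_sq_lt
      rw [mul_pow, Real.sin_sq, hcos]
      have : l ^ 2 * (1 - (-s / l) ^ 2) = l ^ 2 - s ^ 2 := by field_simp
      rw [this]
      nlinarith
    rw [hcos, div_add_div _ _ hsin.ne' hq'.ne']
    refine div_neg_of_neg_of_pos ?_ (mul_pos hsin hq')
    have : -s / l * √(r ^ 2 - s ^ 2) + Real.sin s * s =
      s / l * (l * Real.sin s - √(r ^ 2 - s ^ 2)) := by field_simp; ring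
    rw [this]
    exact mul_neg_of_pos_of_neg (by positivity) (by linarith)
  obtain ⟨θ, hθ, hlt⟩ := exists_gt_left_of_hasDerivAt_neg hsh
    (hasDerivAt_log_sin_sub_sqrt hs hsr hsp) hneg
  have hθ0 : 0 < θ := by linarith [Real.pi_pos, hθ.1]
  have hθsin : 0 < Real.sin θ := Real.sin_pos_of_pos_of_lt_pi hθ0 (hθ.2.trans hsp)
  have hθq : 0 < r ^ 2 - θ ^ 2 := by nlinarith [hθ.2]
  have hθq' := Real.sqrt_pos.2 hθq
  set ρ := Real.exp (-√(r ^ 2 - θ ^ 2)) with hρ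
  have hρ0 : 0 < ρ := Real.exp_pos _
  have hρ1 : ρ < 1 := Real.exp_lt_one_iff.2 (by linarith)
  set p : ℂ := ρ * (Complex.cos θ + Complex.sin θ * Complex.I) with hpdef
  have hparg : Complex.arg p = θ :=
    Complex.arg_mul_cos_add_sin_mul_I hρ0 ⟨by linarith, (hθ.2.trans hsp).le⟩
  have hpim : p.im = ρ * Real.sin θ := by
    rw [hpdef, ← Complex.ofReal_cos, ← Complex.ofReal_sin, Complex.im_ofReal_mul, Complex.add_im,
      Complex.ofReal_im, Complex.im_ofReal_mul, Complex.I_im, zero_add, mul_one]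
  have hpn : ‖p‖ = ρ := by
    have := Complex.norm_mul_sin_arg p
    rw [hparg, hpim] at this
    exact mul_right_cancel₀ hθsin.ne' this
  have hpD : p ∉ logDisk r := by
    rw [mem_logDisk_iff hr, hparg, hpn, hρ, Real.log_exp, neg_sq, Real.sq_sqrt hθq.le]
    simp
  have hpos : 0 < p.im := hpim ▸ mul_pos hρ0 hθsin
  have hneck : Real.log (Real.sin s) - √(r ^ 2 - s ^ 2) < Real.log p.im := by
    rw [hpim, Real.log_mul hρ0.ne' hθsin.ne', hρ, Real.log_exp]
    linarith
  have hdir : ∀ v : ℂ, v ≠ 0 → (∀ t : ℝ, 0 ≤ t → p + t • v ∈ (logDisk r)ᶜ) →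
      v.re < 0 ∧ v.im < 0 := fun v hv h =>
    direction_of_ray_avoiding_logDisk hs hsp hsr (hpn ▸ hρ1) hpos (hparg ▸ hθ.2)
      (hparg ▸ hθ.1.le) hneck hv h
  refine not_rayCoverable_of_rays hpos hpD (fun h => hpD ((conj_mem_logDisk_iff hr).1 h)) hdir ?_
  intro v hv h
  have := hdir ((starRingEnd ℂ) v) (by simpa using hv) fun t ht hmem => h t ht ?_
  · simpa using this
  · rw [← conj_mem_logDisk_iff hr]
    simpa using hmem

/-! ### The critical inequality and the conclusion. -/

/-- Beyond `π / 2` the function `cos t + t / l` has its minimum, zero, at `s`; decreasing `l` to `r`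
only increases `θ / l`. -/
theorem neg_div_le_cos_of_le {l s r : ℝ} (hsh : Real.pi / 2 < s) (hsp : s < Real.pi)
    (hsl : s < l) (hcos : Real.cos s = -s / l) (hsin : Real.sin s = 1 / l) (hrl : r ≤ l)
    (hlp : l < Real.pi) {θ : ℝ} (hθ : θ ∈ Ioo 0 r) : -(θ / r) ≤ Real.cos θ := by
  have hr : 0 < r := hθ.1.trans hθ.2
  have hl : 0 < l := hr.trans_le hrl
  rcases le_total θ (Real.pi / 2) with h | h
  · have h1 := Real.cos_nonneg_of_neg_pi_div_two_le_of_le (by linarith [hθ.1, Real.pi_pos]) h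
    have h2 : 0 ≤ θ / r := div_nonneg hθ.1.le hr.le
    linarith
  · have hθp : θ < Real.pi := hθ.2.trans_le (hrl.trans hlp.le)
    -- `t ↦ cos t + t / l` is antitone before `s` and monotone after
    have hd : ∀ t, HasDerivAt (fun t => Real.cos t + t / l) (-Real.sin t + 1 / l) t := fun t =>
      (Real.hasDerivAt_cos t).add ((hasDerivAt_id t).div_const l)
    have hsanti : ∀ a b, Real.pi / 2 ≤ a → a ≤ b → b ≤ Real.pi → Real.sin b ≤ Real.sin a := by
      intro a b ha hab hb
      rw [← Real.cos_sub_pi_div_two, ← Real.cos_sub_pi_div_two]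
      exact Real.cos_le_cos_of_nonneg_of_le_pi (by linarith) (by linarith [Real.pi_pos])
        (by linarith)
    have key : Real.cos s + s / l ≤ Real.cos θ + θ / l := by
      rcases le_total θ s with hθs | hθs
      · refine antitoneOn_of_deriv_nonpos (f := fun t => Real.cos t + t / l) (convex_Icc θ s)
          (fun t _ => (hd t).continuousAt.continuousWithinAt)
          (fun t _ => (hd t).differentiableAt.differentiableWithinAt) (fun t ht => ?_)
          (left_mem_Icc.2 hθs) (right_mem_Icc.2 hθs) hθs
        have ht := interior_subset ht
        rw [(hd t).deriv, ← hsin]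
        linarith [hsanti t s (h.trans ht.1) ht.2 hsp.le]
      · refine monotoneOn_of_deriv_nonneg (f := fun t => Real.cos t + t / l) (convex_Icc s θ)
          (fun t _ => (hd t).continuousAt.continuousWithinAt)
          (fun t _ => (hd t).differentiableAt.differentiableWithinAt) (fun t ht => ?_)
          (left_mem_Icc.2 hθs) (right_mem_Icc.2 hθs) hθs
        have ht := interior_subset ht
        rw [(hd t).deriv, ← hsin]
        linarith [hsanti s t hsh.le ht.1 (ht.2.trans hθp.le)]
    have h0 : Real.cos s + s / l = 0 := by rw [hcos]; ring
    have h2 : θ / l ≤ θ / r := div_le_div_of_nonneg_left hθ.1.le hr hrl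
    linarith

theorem theorem3p2 :
    ∃ l : ℝ, (2 < l ∧ l < Real.pi ∧ lambdaFun l = 0) ∧
      (∀ z : ℝ, 2 < z → z < Real.pi → lambdaFun z = 0 → z = l) ∧
      |l - 2.97169| < 0.000005 ∧
      ∀ (x : EuclideanSpace ℝ (Fin 2)), x ≠ 0 → ∀ r : ℝ, 0 < r →
        (r ≤ l → IsCloseToConvex (qhBall ({0}ᶜ : Set (EuclideanSpace ℝ (Fin 2))) x r)) ∧
        (l < r → ¬ IsCloseToConvex (qhBall ({0}ᶜ : Set (EuclideanSpace ℝ (Fin 2))) x r)) := by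
  obtain ⟨l, hl, h0⟩ := intermediate_value_Ioo' (by norm_num : (2.971685 : ℝ) ≤ 2.971695)
    continuous_lambdaFun.continuousOn ⟨lambdaFun_right_neg, lambdaFun_left_pos⟩
  have h2 : 2 < l := by linarith [hl.1]
  have hp : l < Real.pi := by linarith [hl.2, Real.pi_gt_d2]
  obtain ⟨hsh, hsp, hsl, hcos, hsin⟩ := cos_sin_of_lambdaFun_eq_zero h2 hp h0
  refine ⟨l, ⟨h2, hp, h0⟩, fun z hz hzp hz0 => ?_, ?_, fun x hx r hr => ⟨fun hrl => ?_,
    fun hlr => ?_⟩⟩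
  · exact lambdaFun_strictAntiOn.injOn ⟨hz.le, hzp.le⟩ ⟨h2.le, hp.le⟩ (hz0.trans h0.symm)
  · rw [abs_lt]
    constructor <;> linarith [hl.1, hl.2]
  · rw [isCloseToConvex_qhBall_iff hx]
    exact rayCoverable_compl_logDisk hr (hrl.trans hp.le) fun θ hθ =>
      neg_div_le_cos_of_le hsh hsp hsl hcos hsin hrl hp hθ
  · rw [isCloseToConvex_qhBall_iff hx]
    exact not_rayCoverable_compl_logDisk hsh hsp hsl hcos hlr
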